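/- All graphs are finite and simple. The Harary index of a graph $G$ is $H(G)=\sum_{\{u,v\}} \frac{1}{d_G(u,v)}$, the sum over all unordered pairs of distinct vertices, where a pair of vertices in different components contributes $0$. For $n\ge 2$ and $0\le k\le n-2$, let $\mathbf{G}_{n,k}$ be the graph of order $n$ obtained from the complete graph $K_{n-k}$ by attaching $n-k$ paths (possibly of length $0$) to its vertices, one at each vertex, whose lengths sum up to $k$ and pairwise differ by at most one. A cut vertex (cut edge) of a graph is a vertex (edge) whose removal increases the number of components. Theorem. For every $n\ge 2$, $$H(K_n)=H(\mathbf{G}_{n,0})>H(\mathbf{G}_{n,1})>H(\mathbf{G}_{n,2})>\cdots>H(\mathbf{G}_{n,n-2})=H(P_n),$$ where $P_n$ is the path on $n$ vertices. Furthermore, if a graph $G$ of order $n\ge 3$ (not necessarily connected) contains a cut vertex or a cut edge, then $$H(G)\le H(\mathbf{G}_{n,1}),$$ with equality if and only if $G$ is isomorphic to $\mathbf{G}_{n,1}$. -/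

import Mathlib

/-- The Harary index of a finite graph: the sum of `1 / d(u, v)` over the unordered pairs of
distinct vertices. The double sum runs over ordered pairs, hence the factor `1 / 2`. A pair in
different components (and a pair `u = v`) contributes `0`, because there `G.dist u v = 0` and
`(0 : ℝ)⁻¹ = 0`. -/
noncomputable def hararyIndex {V : Type*} [Fintype V] (G : SimpleGraph V) : ℝ :=
  (1 / 2) * ∑ u : V, ∑ v : V, (G.dist u v : ℝ)⁻¹

/-- A cut vertex: a vertex whose removal increases the number of components. -/
def IsCutVertex {V : Type*} (G : SimpleGraph V) (v : V) : Prop :=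
  Nat.card G.ConnectedComponent < Nat.card (G.induce {v}ᶜ).ConnectedComponent

/-- A cut edge: an edge that is a bridge. -/
def IsCutEdge {V : Type*} (G : SimpleGraph V) (e : Sym2 V) : Prop :=
  e ∈ G.edgeSet ∧ G.IsBridge e

/-- The complete graph on the `m` vertices `⟨i, 0⟩`, with a path
`⟨i, 0⟩, ⟨i, 1⟩, …, ⟨i, ℓ i⟩` of length `ℓ i` attached at the vertex `⟨i, 0⟩` for each `i`. -/
def cliqueWithPaths {m : ℕ} (ℓ : Fin m → ℕ) : SimpleGraph (Σ i : Fin m, Fin (ℓ i + 1)) where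
  Adj x y := x ≠ y ∧
    ((x.2.val = 0 ∧ y.2.val = 0) ∨
      (x.1 = y.1 ∧ (x.2.val + 1 = y.2.val ∨ y.2.val + 1 = x.2.val)))
  symm := ⟨by
    rintro x y ⟨hne, h⟩
    refine ⟨hne.symm, ?_⟩
    rcases h with ⟨h1, h2⟩ | ⟨h1, h2⟩
    · exact Or.inl ⟨h2, h1⟩
    · exact Or.inr ⟨h1.symm, h2.symm⟩⟩
  loopless := ⟨fun _ h => h.1 rfl⟩

/-- The distribution of the total length `k` over `n - k` paths as equally as possible. -/
def evenLengths (n k : ℕ) (i : Fin (n - k)) : ℕ :=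
  k / (n - k) + if i.val < k % (n - k) then 1 else 0

/-- Any two of the lengths differ by at most one. -/
theorem evenLengths_almost_equal (n k : ℕ) (i j : Fin (n - k)) :
    evenLengths n k i ≤ evenLengths n k j + 1 := by
  unfold evenLengths
  split_ifs <;> omega

/-- The lengths sum up to `k`. -/
theorem sum_evenLengths (n k : ℕ) (h : k < n) : ∑ i, evenLengths n k i = k := by
  have hm : k % (n - k) < n - k := Nat.mod_lt _ (by omega)
  have h1 : ∑ i : Fin (n - k), (if i.val < k % (n - k) then 1 else 0) = k % (n - k) := by
    rw [Fin.sum_univ_eq_sum_range (fun i => if i < k % (n - k) then 1 else 0) (n - k),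
      Finset.sum_boole]
    have : (Finset.range (n - k)).filter (fun i => i < k % (n - k))
        = Finset.range (k % (n - k)) := by
      ext i; simp; omega
    simp [this]
  simp only [evenLengths, Finset.sum_add_distrib, h1]
  simp [Nat.div_add_mod]

/-- The vertex set of `graphG n k`. -/
abbrev VertexG (n k : ℕ) : Type := Σ i : Fin (n - k), Fin (evenLengths n k i + 1)

/-- The graph obtained from the complete graph on `n - k` vertices by attaching `n - k` paths of
almost equal lengths to its vertices, one at each; the lengths sum up to `k`. -/
def graphG (n k : ℕ) : SimpleGraph (VertexG n k) := cliqueWithPaths (evenLengths n k)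

/-- The graph `graphG n k` has order `n`. -/
theorem card_vertexG (n k : ℕ) (h : k < n) : Fintype.card (VertexG n k) = n := by
  simp [Finset.sum_add_distrib, sum_evenLengths n k h]
  omega

/-! Two attached paths on `x` and `y` vertices, joined by a clique edge, form a path on `x + y`
vertices, and distances in it agree with those in the whole graph. So the index of a clique with
attached paths depends only on the sizes `p i`, through `pathH`. Moving an end vertex from path `i`
to path `j` keeps the contribution of these two paths together; against any other path the change is
a difference of gaps of harmonic numbers, which are concave. Hence moves towards balance never
decrease the index (`totalH_move`, `totalH_le_of_balanced`). The step from `k + 1` to `k` adds an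
empty path, moves one vertex to it from a path with at least two, which is a strict gain thanks to a
third path, and then balances. With two paths the graph is `P_n`.

A cut vertex or cut edge yields a vertex `c` and a partition of the rest into nonempty `S`, `T` with
no edge between them. The `|S||T|` cross pairs contribute at most `1/2` each, and `|S||T| ≥ |S| +
|T| - 1 = n - 2`. Equality forces one side to be a single vertex and all other pairs to be adjacent:
a clique with a pendant vertex (`IsSeparation.hararyIndex_le`). -/

/-! ### Computing distances; isomorphism invariance -/

/-- Descending along `hstep` gives a walk of length `δ v`; since `δ` grows by at most one per edge,
no walk is shorter. -/
theorem SimpleGraph.dist_eq_of_step {V : Type*} (G : SimpleGraph V) (u : V) (δ : V → ℕ)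
    (h0 : ∀ v, δ v = 0 ↔ v = u) (hle : ∀ v w, G.Adj v w → δ w ≤ δ v + 1)
    (hstep : ∀ v, δ v ≠ 0 → ∃ w, G.Adj w v ∧ δ v = δ w + 1) (v : V) : G.dist u v = δ v := by
  have hwalk : ∀ (d : ℕ) (v : V), δ v = d → ∃ p : G.Walk u v, p.length = d := by
    intro d
    induction d with
    | zero =>
      intro v hv
      obtain rfl := (h0 v).1 hv
      exact ⟨.nil, rfl⟩
    | succ d ih =>
      intro v hv
      obtain ⟨w, hw, hd⟩ := hstep v (by omega)
      obtain ⟨p, hp⟩ := ih w (by omega)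
      exact ⟨p.concat hw, by simp [hp]⟩
  have hlow : ∀ (x y : V) (p : G.Walk x y), δ y ≤ δ x + p.length := by
    intro x y p
    induction p with
    | nil => simp
    | cons h p ih => have := hle _ _ h; simp only [SimpleGraph.Walk.length_cons]; omega
  obtain ⟨p, hp⟩ := hwalk _ v rfl
  apply le_antisymm (hp ▸ SimpleGraph.dist_le p)
  obtain ⟨p', hp'⟩ := p.reachable.exists_walk_length_eq_dist
  have := hlow _ _ p'
  rw [(h0 u).2 rfl] at this
  omega

theorem hararyIndex_iso {V W : Type*} [Fintype V] [Fintype W] {G : SimpleGraph V}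
    {H : SimpleGraph W} (e : G ≃g H) : hararyIndex G = hararyIndex H := by
  have hdist : ∀ u v, H.dist (e u) (e v) = G.dist u v := by
    intro u v
    by_cases huv : G.Reachable u v
    · apply le_antisymm
      · obtain ⟨p, hp⟩ := huv.exists_walk_length_eq_dist
        rw [← hp, ← SimpleGraph.Walk.length_map e.toHom p]
        exact SimpleGraph.dist_le _
      · obtain ⟨p, hp⟩ := (huv.map e.toHom).exists_walk_length_eq_dist
        have h1 := SimpleGraph.dist_le (p.map e.symm.toHom)
        rw [SimpleGraph.Walk.length_map, hp] at h1
        simpa using h1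
    · rw [SimpleGraph.dist_eq_zero_of_not_reachable huv,
        SimpleGraph.dist_eq_zero_of_not_reachable (by rwa [SimpleGraph.Iso.reachable_iff])]
  unfold hararyIndex
  congr 1
  rw [← e.toEquiv.sum_comp]
  refine Finset.sum_congr rfl fun u _ => ?_
  rw [← e.toEquiv.sum_comp]
  refine Finset.sum_congr rfl fun v _ => ?_
  rw [← hdist u v]
  rfl

/-! ### Harmonic sums and the index of a path -/

/-- The harmonic number `1 + 1/2 + ⋯ + 1/n`, as a real number. -/
noncomputable def harm (n : ℕ) : ℝ := ∑ t ∈ Finset.range n, ((t : ℝ) + 1)⁻¹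

/-- The Harary index of the path on `n` vertices. -/
noncomputable def pathH (n : ℕ) : ℝ := ∑ t ∈ Finset.range n, harm t

@[simp] theorem harm_zero : harm 0 = 0 := rfl
@[simp] theorem pathH_zero : pathH 0 = 0 := rfl
theorem harm_succ (n : ℕ) : harm (n + 1) = harm n + ((n : ℝ) + 1)⁻¹ := Finset.sum_range_succ _ _
theorem pathH_succ (n : ℕ) : pathH (n + 1) = pathH n + harm n := Finset.sum_range_succ _ _

theorem sum_inv_add (a y : ℕ) :
    ∑ b ∈ Finset.range y, ((a : ℝ) + b + 1)⁻¹ = harm (a + y) - harm a := by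
  induction y with
  | zero => simp
  | succ y ih => rw [Finset.sum_range_succ, ih, ← add_assoc, harm_succ]; push_cast; ring

theorem sum_harm_add (x y : ℕ) :
    ∑ a ∈ Finset.range x, harm (a + y) = pathH (x + y) - pathH y := by
  induction x with
  | zero => simp
  | succ x ih =>
    rw [Finset.sum_range_succ, ih, show x + 1 + y = x + y + 1 by ring, pathH_succ]; ring

/-- Cutting a path on `x + y` vertices into two, the cross pairs are all pairs minus those inside
each piece. -/
theorem sum_sum_inv_add (x y : ℕ) :
    ∑ a ∈ Finset.range x, ∑ b ∈ Finset.range y, (((a + b + 1 : ℕ) : ℝ))⁻¹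
      = pathH (x + y) - pathH x - pathH y := by
  push_cast
  simp_rw [sum_inv_add]
  rw [Finset.sum_sub_distrib, sum_harm_add, pathH, pathH, pathH]
  ring

theorem sum_inv_sub (n : ℕ) :
    ∑ a ∈ Finset.range n, (((n - a : ℕ)) : ℝ)⁻¹ = harm n := by
  rw [harm, ← Finset.sum_range_reflect]
  refine Finset.sum_congr rfl fun a ha => ?_
  have := Finset.mem_range.1 ha
  rw [show n - (n - 1 - a) = a + 1 by omega]
  push_cast; rfl

/-- With truncated subtraction the denominator is `|a - b|`, and the diagonal vanishes because `0⁻¹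
= 0`. Each new end vertex adds `harm n` in both orders. -/
theorem sum_sum_inv_dist (n : ℕ) :
    ∑ a ∈ Finset.range n, ∑ b ∈ Finset.range n, (((a - b) + (b - a) : ℕ) : ℝ)⁻¹
      = 2 * pathH n := by
  induction n with
  | zero => simp
  | succ n ih =>
    rw [Finset.sum_range_succ]
    simp_rw [Finset.sum_range_succ (n := n)]
    rw [Finset.sum_add_distrib, ih, pathH_succ, ← sum_inv_sub n]
    have h1 : ∑ a ∈ Finset.range n, (((a - n) + (n - a) : ℕ) : ℝ)⁻¹
        = ∑ a ∈ Finset.range n, (((n - a : ℕ)) : ℝ)⁻¹ :=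
      Finset.sum_congr rfl fun a ha => by
        have := Finset.mem_range.1 ha
        rw [show a - n + (n - a) = n - a by omega]
    have h2 : ∑ a ∈ Finset.range n, (((n - a) + (a - n) : ℕ) : ℝ)⁻¹
        = ∑ a ∈ Finset.range n, (((n - a : ℕ)) : ℝ)⁻¹ :=
      Finset.sum_congr rfl fun a ha => by
        have := Finset.mem_range.1 ha
        rw [show n - a + (a - n) = n - a by omega]
    rw [h1, h2]
    simp
    ring

theorem hararyIndex_pathGraph (n : ℕ) : hararyIndex (SimpleGraph.pathGraph n) = pathH n := by
  have hd : ∀ u v : Fin n, (SimpleGraph.pathGraph n).dist u v = (u.val - v.val) + (v.val - u.val) := by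
    intro u
    apply SimpleGraph.dist_eq_of_step
    · intro v
      rw [Fin.ext_iff]; omega
    · intro v w h
      rw [SimpleGraph.pathGraph_adj] at h
      omega
    · intro v hv
      by_cases h : u.val < v.val
      · refine ⟨⟨v.val - 1, by omega⟩, ?_, ?_⟩
        · rw [SimpleGraph.pathGraph_adj]; simp only; omega
        · simp only; omega
      · have := u.isLt
        refine ⟨⟨v.val + 1, by omega⟩, ?_, ?_⟩
        · rw [SimpleGraph.pathGraph_adj]; simp
        · simp only; omega
  unfold hararyIndex
  simp_rw [hd]
  rw [Fin.sum_univ_eq_sum_range (fun a => ∑ v : Fin n, (((a - v.val) + (v.val - a) : ℕ) : ℝ)⁻¹) n]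
  have : ∀ a, ∑ v : Fin n, (((a - v.val) + (v.val - a) : ℕ) : ℝ)⁻¹
      = ∑ b ∈ Finset.range n, (((a - b) + (b - a) : ℕ) : ℝ)⁻¹ := fun a =>
    Fin.sum_univ_eq_sum_range (fun b => (((a - b) + (b - a) : ℕ) : ℝ)⁻¹) n
  simp_rw [this]
  rw [sum_sum_inv_dist]
  ring

/-! ### The index of a clique with attached paths -/

theorem cliqueWithPaths_dist {m : ℕ} (ℓ : Fin m → ℕ) (x y : Σ i : Fin m, Fin (ℓ i + 1)) :
    (cliqueWithPaths ℓ).dist x y = if x.1 = y.1 then (x.2.val - y.2.val) + (y.2.val - x.2.val)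
      else x.2.val + y.2.val + 1 := by
  have hext : ∀ v w : (Σ i : Fin m, Fin (ℓ i + 1)), v = w ↔ v.1 = w.1 ∧ v.2.val = w.2.val := by
    rintro ⟨i, a⟩ ⟨j, b⟩
    constructor
    · rintro h; cases h; exact ⟨rfl, rfl⟩
    · rintro ⟨h1, h2⟩
      dsimp only at h1
      subst h1
      exact congrArg (Sigma.mk i) (Fin.ext h2)
  revert y
  apply SimpleGraph.dist_eq_of_step
  · intro v
    rw [hext]
    by_cases h : x.1 = v.1
    · simp only [h, if_true, true_and]; omega
    · simp [h, Ne.symm h]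
  · rintro v w ⟨-, h⟩
    by_cases h1 : x.1 = v.1 <;> by_cases h2 : x.1 = w.1
    · rw [if_pos h1, if_pos h2]; omega
    · rcases h with h | ⟨h, _⟩
      · rw [if_neg h2, if_pos h1]; omega
      · exact absurd (h1.trans h) h2
    · rcases h with h | ⟨h, _⟩
      · rw [if_neg h1, if_pos h2]; omega
      · exact absurd (h2.trans h.symm) h1
    · rw [if_neg h1, if_neg h2]; omega
  · intro v hv
    have hv2 := v.2.isLt
    have hx2 := x.2.isLt
    by_cases h : x.1 = v.1
    · rw [if_pos h] at hv ⊢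
      by_cases h' : x.2.val < v.2.val
      · refine ⟨⟨v.1, ⟨v.2.val - 1, by omega⟩⟩, ⟨?_, Or.inr ⟨rfl, ?_⟩⟩, ?_⟩
        · rw [Ne, hext]; simp only; omega
        · simp only; omega
        · rw [if_pos h]; simp only; omega
      -- Here `v` lies strictly below `x` on the same path, so the next vertex up exists.
      · refine ⟨⟨v.1, ⟨v.2.val + 1, by have := congrArg ℓ h; omega⟩⟩, ⟨?_, Or.inr ⟨rfl, ?_⟩⟩, ?_⟩
        · rw [Ne, hext]; simp only; omega
        · simp
        · rw [if_pos h]; simp only; omega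
    · rw [if_neg h]
      by_cases h' : v.2.val = 0
      · refine ⟨⟨x.1, 0⟩, ⟨?_, Or.inl ⟨rfl, h'⟩⟩, ?_⟩
        · rw [Ne, hext]; simp [h]
        · simp [h']
      · refine ⟨⟨v.1, ⟨v.2.val - 1, by omega⟩⟩, ⟨?_, Or.inr ⟨rfl, ?_⟩⟩, ?_⟩
        · rw [Ne, hext]; simp only; omega
        · simp only; omega
        · rw [if_neg h]; simp only; omega

/-- Twice the contribution to the Harary index of two attached paths on `x` and `y` vertices
(`x = y` being the same path if `same` holds). -/
noncomputable def pairH {ι : Type*} [DecidableEq ι] (p : ι → ℕ) (i j : ι) : ℝ :=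
  if i = j then 2 * pathH (p i) else pathH (p i + p j) - pathH (p i) - pathH (p j)

theorem hararyIndex_cliqueWithPaths {m : ℕ} (ℓ : Fin m → ℕ) :
    hararyIndex (cliqueWithPaths ℓ) = (1 / 2) * ∑ i, ∑ j, pairH (fun i => ℓ i + 1) i j := by
  unfold hararyIndex
  congr 1
  rw [Fintype.sum_sigma]
  refine Finset.sum_congr rfl fun i _ => ?_
  simp_rw [Fintype.sum_sigma]
  rw [Finset.sum_comm]
  refine Finset.sum_congr rfl fun j _ => ?_
  simp_rw [cliqueWithPaths_dist]
  unfold pairH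
  by_cases h : i = j
  · subst h
    simp only [if_true]
    rw [← sum_sum_inv_dist, ← Fin.sum_univ_eq_sum_range]
    refine Finset.sum_congr rfl fun a _ => ?_
    rw [← Fin.sum_univ_eq_sum_range]
  · simp only [h, if_false]
    rw [← sum_sum_inv_add, ← Fin.sum_univ_eq_sum_range]
    refine Finset.sum_congr rfl fun a _ => ?_
    rw [← Fin.sum_univ_eq_sum_range]

theorem pairH_comm {ι : Type*} [DecidableEq ι] (p : ι → ℕ) (i j : ι) :
    pairH p i j = pairH p j i := by
  unfold pairH
  by_cases h : i = j
  · subst h; rfl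
  · rw [if_neg h, if_neg (Ne.symm h), add_comm (p i)]; ring

/-- Twice the Harary index of a clique with attached paths having `p i` vertices each. -/
noncomputable def totalH {ι : Type*} [Fintype ι] [DecidableEq ι] (p : ι → ℕ) : ℝ :=
  ∑ i, ∑ j, pairH p i j

theorem sum_split_two {ι M : Type*} [Fintype ι] [DecidableEq ι] [AddCommMonoid M] (f : ι → M)
    {i j : ι} (hij : i ≠ j) : ∑ x, f x = f i + f j + ∑ x ∈ ({i, j} : Finset ι)ᶜ, f x := by
  rw [← Finset.sum_add_sum_compl {i, j}, Finset.sum_pair hij]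

theorem sum_sum_split_two {ι : Type*} [Fintype ι] [DecidableEq ι] (g : ι → ι → ℝ)
    (hg : ∀ x y, g x y = g y x) {i j : ι} (hij : i ≠ j) :
    ∑ x, ∑ y, g x y = (g i i + g j j + 2 * g i j)
      + 2 * ∑ x ∈ ({i, j} : Finset ι)ᶜ, (g i x + g j x)
      + ∑ x ∈ ({i, j} : Finset ι)ᶜ, ∑ y ∈ ({i, j} : Finset ι)ᶜ, g x y := by
  rw [sum_split_two _ hij]
  simp_rw [sum_split_two (g _) hij]
  simp only [Finset.sum_add_distrib]
  rw [hg j i, Finset.sum_congr rfl fun x _ => hg x i, Finset.sum_congr rfl fun x _ => hg x j]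
  ring

/-- Concavity of `harm`: the gaps compare term by term. -/
theorem harm_gap (a b c : ℕ) (hab : b ≤ a) : harm (a + c) - harm a ≤ harm (b + c) - harm b := by
  rw [← sum_inv_add, ← sum_inv_add]
  refine Finset.sum_le_sum fun t _ => ?_
  have : (b : ℝ) ≤ a := by exact_mod_cast hab
  gcongr

theorem harm_gap_strict (a b c : ℕ) (hab : b < a) (hc : 0 < c) :
    harm (a + c) - harm a < harm (b + c) - harm b := by
  rw [← sum_inv_add, ← sum_inv_add]
  refine Finset.sum_lt_sum_of_nonempty ⟨0, Finset.mem_range.2 hc⟩ fun t _ => ?_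
  have : (b : ℝ) < a := by exact_mod_cast hab
  gcongr

/-! ### Moving an end vertex between paths -/

section Move

variable {ι : Type*} [DecidableEq ι] {p p' : ι → ℕ} {i j : ι}

/-- The function obtained by moving one unit from `i` to `j`. -/
def moveUnit (p : ι → ℕ) (i j : ι) : ι → ℕ :=
  Function.update (Function.update p i (p i - 1)) j (p j + 1)

theorem moveUnit_src (hij : i ≠ j) : moveUnit p i j i = p i - 1 := by simp [moveUnit, hij]

theorem moveUnit_dst : moveUnit p i j j = p j + 1 := by simp [moveUnit]

theorem moveUnit_of_ne {x : ι} (hi : x ≠ i) (hj : x ≠ j) : moveUnit p i j x = p x := by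
  simp [moveUnit, hi, hj]

variable [Fintype ι]

/-- The effect of moving one vertex from the end of path `i` to the end of path `j`. -/
theorem totalH_move (hij : i ≠ j) (hi : p i = p' i + 1) (hj : p' j = p j + 1)
    (h : ∀ x, x ≠ i → x ≠ j → p' x = p x) :
    totalH p' - totalH p = 2 * ∑ x ∈ ({i, j} : Finset ι)ᶜ,
      ((harm (p j + p x) - harm (p j)) - (harm (p' i + p x) - harm (p' i))) := by
  unfold totalH
  rw [sum_sum_split_two _ (pairH_comm p) hij, sum_sum_split_two _ (pairH_comm p') hij]
  -- Both sides are `2 * pathH (p i + p j)`, since the move preserves the sum of the two sizes.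
  have h1 : pairH p' i i + pairH p' j j + 2 * pairH p' i j
      = pairH p i i + pairH p j j + 2 * pairH p i j := by
    simp only [pairH, if_true, if_neg hij, hi, hj]
    rw [show p' i + (p j + 1) = p' i + 1 + p j by ring]
    ring
  have h2 : ∑ x ∈ ({i, j} : Finset ι)ᶜ, ∑ y ∈ ({i, j} : Finset ι)ᶜ, pairH p' x y
      = ∑ x ∈ ({i, j} : Finset ι)ᶜ, ∑ y ∈ ({i, j} : Finset ι)ᶜ, pairH p x y := by
    refine Finset.sum_congr rfl fun x hx => Finset.sum_congr rfl fun y hy => ?_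
    simp only [Finset.mem_compl, Finset.mem_insert, Finset.mem_singleton, not_or] at hx hy
    simp only [pairH, h x hx.1 hx.2, h y hy.1 hy.2]
  have h3 : ∑ x ∈ ({i, j} : Finset ι)ᶜ, (pairH p' i x + pairH p' j x)
      = ∑ x ∈ ({i, j} : Finset ι)ᶜ, (pairH p i x + pairH p j x)
        + ∑ x ∈ ({i, j} : Finset ι)ᶜ,
          ((harm (p j + p x) - harm (p j)) - (harm (p' i + p x) - harm (p' i))) := by
    rw [← Finset.sum_add_distrib]
    refine Finset.sum_congr rfl fun x hx => ?_
    simp only [Finset.mem_compl, Finset.mem_insert, Finset.mem_singleton, not_or] at hx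
    simp only [pairH, if_neg (Ne.symm hx.1), if_neg (Ne.symm hx.2), h x hx.1 hx.2, hi, hj]
    rw [show p j + 1 + p x = p j + p x + 1 by ring, show p' i + 1 + p x = p' i + p x + 1 by ring]
    simp only [pathH_succ]
    ring
  rw [h1, h2, h3]
  ring

theorem totalH_le_move (hij : i ≠ j) (hi : p i = p' i + 1) (hj : p' j = p j + 1)
    (h : ∀ x, x ≠ i → x ≠ j → p' x = p x) (hle : p j ≤ p' i) : totalH p ≤ totalH p' := by
  rw [← sub_nonneg, totalH_move hij hi hj h]
  refine mul_nonneg zero_le_two (Finset.sum_nonneg fun x _ => ?_)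
  exact sub_nonneg.2 (harm_gap _ _ _ hle)

theorem totalH_lt_move (hij : i ≠ j) (hi : p i = p' i + 1) (hj : p' j = p j + 1)
    (h : ∀ x, x ≠ i → x ≠ j → p' x = p x) (hlt : p j < p' i) {x : ι} (hxi : x ≠ i) (hxj : x ≠ j)
    (hx : 0 < p x) : totalH p < totalH p' := by
  rw [← sub_pos, totalH_move hij hi hj h]
  refine mul_pos zero_lt_two (Finset.sum_pos' (fun x _ => sub_nonneg.2 (harm_gap _ _ _ hlt.le)) ?_)
  exact ⟨x, by simp [hxi, hxj], sub_pos.2 (harm_gap_strict _ _ _ hlt hx)⟩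

theorem sum_moveUnit (hij : i ≠ j) (hi : 0 < p i) : ∑ x, moveUnit p i j x = ∑ x, p x := by
  rw [sum_split_two _ hij, sum_split_two p hij, moveUnit_src hij, moveUnit_dst]
  have : ∑ x ∈ ({i, j} : Finset ι)ᶜ, moveUnit p i j x = ∑ x ∈ ({i, j} : Finset ι)ᶜ, p x := by
    refine Finset.sum_congr rfl fun x hx => ?_
    simp only [Finset.mem_compl, Finset.mem_insert, Finset.mem_singleton, not_or] at hx
    exact moveUnit_of_ne hx.1 hx.2
  omega

/-- Induction on the total excess of `p` over `q`: a unit moved from an overfull index to an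
underfull one lowers the excess. -/
theorem totalH_le_of_balanced {q : ι → ℕ} (hq : ∀ i j, q i ≤ q j + 1) (p : ι → ℕ)
    (hsum : ∑ x, p x = ∑ x, q x) : totalH p ≤ totalH q := by
  induction hd : ∑ x, (p x - q x) using Nat.strong_induction_on generalizing p with
  | _ d ih =>
  by_cases hpq : ∀ x, p x ≤ q x
  · have : p = q := by
      funext x
      exact (Finset.sum_eq_sum_iff_of_le fun x _ => hpq x).1 hsum x (Finset.mem_univ x)
    rw [this]
  · push Not at hpq
    obtain ⟨i, hi⟩ := hpq
    obtain ⟨j, hj⟩ : ∃ j, p j < q j := by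
      by_contra! hcon
      exact (Finset.sum_lt_sum (fun x _ => hcon x) ⟨i, Finset.mem_univ i, hi⟩).ne' hsum
    have hij : i ≠ j := by rintro rfl; omega
    have hqij := hq j i
    have hlt : ∑ x, (moveUnit p i j x - q x) < d := by
      rw [← hd]
      refine Finset.sum_lt_sum (fun x _ => ?_) ⟨i, Finset.mem_univ i, ?_⟩
      · by_cases hxi : x = i
        · subst hxi; rw [moveUnit_src hij]; omega
        · by_cases hxj : x = j
          · subst hxj; rw [moveUnit_dst]; omega
          · rw [moveUnit_of_ne hxi hxj]
      · rw [moveUnit_src hij]; omega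
    refine le_trans ?_ (ih _ hlt (moveUnit p i j) ((sum_moveUnit hij (by omega)).trans hsum) rfl)
    -- The move is admissible because `p j + 1 ≤ q j ≤ q i + 1 ≤ p i`.
    refine totalH_le_move hij ?_ moveUnit_dst (fun x => moveUnit_of_ne) ?_
    · rw [moveUnit_src hij]; omega
    · rw [moveUnit_src hij]; omega

end Move

/-! ### The strictly decreasing chain -/

/-- An empty path contributes nothing, which lets size distributions over `m` and `m + 1` paths be
compared. -/
theorem totalH_snoc_zero {m : ℕ} (p : Fin m → ℕ) :
    totalH (Fin.snoc p 0 : Fin (m + 1) → ℕ) = totalH p := by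
  simp [totalH, Fin.sum_univ_castSucc, pairH, Fin.castSucc_ne_last, (Fin.castSucc_ne_last _).symm]

theorem totalH_lt_of_card_lt {m m' : ℕ} (hm' : m' = m + 1) (hm : 2 ≤ m) {p : Fin m → ℕ}
    {q : Fin m' → ℕ} (hp : ∀ i, 0 < p i) (hq : ∀ i j, q i ≤ q j + 1)
    (hsum : ∑ x, p x = ∑ x, q x) (hbig : m < ∑ x, p x) : totalH p < totalH q := by
  subst hm'
  obtain ⟨i, hi⟩ : ∃ i, 2 ≤ p i := by
    by_contra! hcon
    have : ∑ x, p x ≤ ∑ _x : Fin m, 1 := Finset.sum_le_sum fun x _ => by have := hcon x; omega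
    simp at this
    omega
  have : Nontrivial (Fin m) := Fin.nontrivial_iff_two_le.2 hm
  -- This third path, distinct from the source and the empty target, makes the gain strict.
  obtain ⟨x, hx⟩ := exists_ne i
  set p₀ : Fin (m + 1) → ℕ := Fin.snoc p 0 with hp₀
  have hlast : p₀ (Fin.last m) = 0 := by simp [hp₀]
  have hcast : ∀ y : Fin m, p₀ y.castSucc = p y := fun y => by simp [hp₀]
  have hne : i.castSucc ≠ Fin.last m := Fin.castSucc_ne_last i
  rw [← totalH_snoc_zero p]
  refine lt_of_lt_of_le ?_ (totalH_le_of_balanced hq (moveUnit p₀ i.castSucc (Fin.last m)) ?_)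
  · refine totalH_lt_move hne ?_ moveUnit_dst (fun x => moveUnit_of_ne) ?_ (x := x.castSucc) ?_
      (Fin.castSucc_ne_last x) ?_
    · rw [moveUnit_src hne, ← hp₀, hcast]; omega
    · rw [moveUnit_src hne, ← hp₀, hcast, hlast]; omega
    · simpa using hx
    · rw [← hp₀, hcast]; exact hp x
  · rw [sum_moveUnit hne (by rw [hcast]; omega), ← hsum, Fin.sum_univ_castSucc, hlast]
    simp [hcast]

theorem hararyIndex_graphG (n k : ℕ) :
    hararyIndex (graphG n k) = (1 / 2) * totalH (fun i => evenLengths n k i + 1) :=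
  hararyIndex_cliqueWithPaths _

theorem sum_evenLengths_succ (n k : ℕ) (h : k < n) : ∑ i, (evenLengths n k i + 1) = n := by
  rw [Finset.sum_add_distrib, sum_evenLengths n k h]
  simp
  omega

theorem hararyIndex_graphG_succ_lt (n k : ℕ) (h : k + 1 ≤ n - 2) :
    hararyIndex (graphG n (k + 1)) < hararyIndex (graphG n k) := by
  rw [hararyIndex_graphG, hararyIndex_graphG]
  refine mul_lt_mul_of_pos_left ?_ (by norm_num)
  refine totalH_lt_of_card_lt (by omega) (by omega) (fun _ => Nat.succ_pos _) ?_ ?_ ?_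
  · intro i j
    have := evenLengths_almost_equal n k i j
    omega
  · rw [sum_evenLengths_succ _ _ (by omega), sum_evenLengths_succ _ _ (by omega)]
  · rw [sum_evenLengths_succ _ _ (by omega)]; omega

theorem totalH_of_card_two {m : ℕ} (hm : m = 2) (p : Fin m → ℕ) :
    totalH p = 2 * pathH (∑ i, p i) := by
  subst hm
  simp [totalH, Fin.sum_univ_two, pairH, add_comm (p 1) (p 0)]
  ring

theorem hararyIndex_graphG_sub_two (n : ℕ) (hn : 2 ≤ n) :
    hararyIndex (graphG n (n - 2)) = hararyIndex (SimpleGraph.pathGraph n) := by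
  rw [hararyIndex_graphG, hararyIndex_pathGraph, totalH_of_card_two (by omega),
    sum_evenLengths_succ _ _ (by omega)]
  ring

theorem graphG_zero_eq_top (n : ℕ) : graphG n 0 = ⊤ := by
  ext x y
  have h : ∀ z : VertexG n 0, z.2.val = 0 := fun z => by
    have h0 : evenLengths n 0 z.1 = 0 := by simp [evenLengths]
    have := z.2.isLt
    omega
  simp [graphG, cliqueWithPaths, h]

theorem hararyIndex_top_eq (n : ℕ) (hn : 0 < n) :
    hararyIndex (⊤ : SimpleGraph (Fin n)) = hararyIndex (graphG n 0) := by
  rw [graphG_zero_eq_top]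
  have e : Fin n ≃ VertexG n 0 := (Fintype.equivFinOfCardEq (card_vertexG n 0 hn)).symm
  exact hararyIndex_iso (SimpleGraph.Iso.completeGraph e)

/-! ### Separations and pendant cliques -/

/-- The parts `S` and `T` of `V \ {c}` are nonempty and not joined by an edge. -/
structure IsSeparation {V : Type*} (G : SimpleGraph V) (c : V) (S T : Finset V) : Prop where
  disj : Disjoint S T
  left_nonempty : S.Nonempty
  right_nonempty : T.Nonempty
  notMem_left : c ∉ S
  notMem_right : c ∉ T
  cover : ∀ x, x = c ∨ x ∈ S ∨ x ∈ T
  not_adj : ∀ x ∈ S, ∀ y ∈ T, ¬ G.Adj x y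

/-- `G` is a complete graph on `V \ {s}` together with the pendant vertex `s` attached at `c`. -/
def IsPendantClique {V : Type*} (G : SimpleGraph V) (s c : V) : Prop :=
  s ≠ c ∧ ∀ x y, G.Adj x y ↔ x ≠ y ∧ (x = s → y = c) ∧ (y = s → x = c)

section

variable {V : Type*} {G : SimpleGraph V} {c s : V} {S T : Finset V}

theorem IsSeparation.symm (h : IsSeparation G c S T) : IsSeparation G c T S :=
  ⟨h.disj.symm, h.right_nonempty, h.left_nonempty, h.notMem_right, h.notMem_left,
    fun x => (h.cover x).imp_right Or.symm, fun x hx y hy hxy => h.not_adj y hy x hx hxy.symm⟩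

/-- The largest possible inverse distance if there are no edges between `S` and `T`. -/
noncomputable def maxInvDist [DecidableEq V] (S T : Finset V) (u v : V) : ℝ :=
  if u = v then 0 else if (u ∈ S ∧ v ∈ T) ∨ (u ∈ T ∧ v ∈ S) then 1 / 2 else 1

theorem IsSeparation.inv_dist_le [DecidableEq V] (h : IsSeparation G c S T) (u v : V) :
    (G.dist u v : ℝ)⁻¹ ≤ maxInvDist S T u v := by
  have hnn : 0 ≤ maxInvDist S T u v := by unfold maxInvDist; split_ifs <;> norm_num
  by_cases h0 : G.dist u v = 0
  · simpa [h0] using hnn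
  have hne : u ≠ v := by rintro rfl; simp at h0
  by_cases h1 : G.dist u v = 1
  · have hadj := SimpleGraph.dist_eq_one_iff_adj.1 h1
    have hcross : ¬ ((u ∈ S ∧ v ∈ T) ∨ (u ∈ T ∧ v ∈ S)) := by
      rintro (⟨hu, hv⟩ | ⟨hu, hv⟩)
      · exact h.not_adj u hu v hv hadj
      · exact h.not_adj v hv u hu hadj.symm
    simp [maxInvDist, hne, hcross, h1]
  · have h2 : (2 : ℝ) ≤ G.dist u v := by exact_mod_cast (by omega : 2 ≤ G.dist u v)
    calc (G.dist u v : ℝ)⁻¹ ≤ 1 / 2 := by rw [← one_div]; gcongr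
      _ ≤ maxInvDist S T u v := by
        unfold maxInvDist
        rw [if_neg hne]
        split_ifs <;> norm_num

variable [Fintype V]

/-- Common form for both kinds of cut: `A` is closed under adjacency away from `c`, and neither `A`
nor its complement reduces to `c`. -/
theorem IsSeparation.exists_of_set (A : Set V) {a b : V} (ha : a ∈ A) (hac : a ≠ c)
    (hb : b ∉ A) (hbc : b ≠ c)
    (hadj : ∀ x y, x ∈ A → y ∉ A → x ≠ c → y ≠ c → ¬ G.Adj x y) :
    ∃ S T : Finset V, IsSeparation G c S T := by
  classical
  refine ⟨Finset.univ.filter fun x => x ∈ A ∧ x ≠ c, Finset.univ.filter fun x => x ∉ A ∧ x ≠ c,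
    ?_, ⟨a, by simp [ha, hac]⟩, ⟨b, by simp [hb, hbc]⟩, by simp, by simp, ?_, ?_⟩
  · rw [Finset.disjoint_left]
    intro x hx hx'
    simp only [Finset.mem_filter] at hx hx'
    exact hx'.2.1 hx.2.1
  · intro x
    simp only [Finset.mem_filter, Finset.mem_univ, true_and]
    tauto
  · intro x hx y hy
    simp only [Finset.mem_filter, Finset.mem_univ, true_and] at hx hy
    exact hadj x y hx.1 hy.1 hx.2 hy.2

theorem IsCutVertex.exists_isSeparation (h : IsCutVertex G c) :
    ∃ S T : Finset V, IsSeparation G c S T := by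
  classical
  unfold IsCutVertex at h
  have hpos : 0 < Nat.card G.ConnectedComponent :=
    Nat.card_pos_iff.2 ⟨⟨G.connectedComponentMk c⟩, inferInstance⟩
  -- Otherwise at most one component remains after the removal, while `G` has at least one, so the
  -- number cannot increase.
  obtain ⟨a, b, hab⟩ : ∃ a b, ¬ (G.induce {c}ᶜ).Reachable a b := by
    by_contra! hcon
    have : Subsingleton (G.induce {c}ᶜ).ConnectedComponent :=
      SimpleGraph.Preconnected.subsingleton_connectedComponent hcon
    have := Finite.card_le_one_iff_subsingleton (α := (G.induce {c}ᶜ).ConnectedComponent) |>.2 this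
    omega
  refine IsSeparation.exists_of_set {x | ∃ hx : x ∈ ({c}ᶜ : Set V), (G.induce {c}ᶜ).Reachable a ⟨x, hx⟩}
    (a := a) (b := b) ⟨a.2, SimpleGraph.Reachable.refl _⟩ a.2 ?_ b.2 ?_
  · rintro ⟨_, hb⟩
    exact hab hb
  · rintro x y ⟨hx, hax⟩ hy hxc hyc hxy
    refine hy ⟨hyc, hax.trans (SimpleGraph.Adj.reachable ?_)⟩
    simpa using hxy

/-- Let `A` be the component of `u` once the bridge `uv` is deleted. The only edge of `G` leaving
`A` is `uv`, so removing either end separates, provided its side has another vertex; a third vertex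
`w` decides which end to take. -/
theorem IsCutEdge.exists_isSeparation {e : Sym2 V} (h : IsCutEdge G e)
    (hcard : 3 ≤ Fintype.card V) : ∃ (c : V) (S T : Finset V), IsSeparation G c S T := by
  classical
  induction e with
  | _ u v =>
  obtain ⟨he, hbr⟩ := h
  rw [SimpleGraph.isBridge_iff] at hbr
  set G' := G.deleteEdges {s(u, v)} with hG'
  have huv : u ≠ v := G.ne_of_adj he
  have hstep : ∀ x y, G'.Reachable u x → ¬ G'.Reachable u y → G.Adj x y → x = u ∧ y = v := by
    intro x y hx hy hxy
    by_cases hs : s(x, y) = s(u, v)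
    · rcases Sym2.eq_iff.1 hs with h | ⟨h, -⟩
      · exact h
      · exact absurd (h ▸ hx) hbr
    · refine absurd (hx.trans (SimpleGraph.Adj.reachable ?_)) hy
      rw [hG', SimpleGraph.deleteEdges_adj]
      exact ⟨hxy, hs⟩
  obtain ⟨w, hw⟩ : ∃ w, w ∉ ({u, v} : Finset V) := by
    by_contra! hcon
    have := Finset.card_le_card (fun x _ => hcon x : (Finset.univ : Finset V) ⊆ {u, v})
    rw [Finset.card_univ, Finset.card_pair huv] at this
    omega
  simp only [Finset.mem_insert, Finset.mem_singleton, not_or] at hw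
  by_cases hwr : G'.Reachable u w
  · exact ⟨u, IsSeparation.exists_of_set {x | G'.Reachable u x} hwr hw.1 hbr huv.symm
      fun x y hx hy hxc _ hxy => hxc (hstep x y hx hy hxy).1⟩
  · exact ⟨v, IsSeparation.exists_of_set {x | G'.Reachable u x} (SimpleGraph.Reachable.refl u) huv hwr hw.2
      fun x y hx hy _ hyc hxy => hyc (hstep x y hx hy hxy).2⟩

/-- Expanded in indicator functions: each cross pair loses `1/2` in each of its two orders. -/
theorem sum_maxInvDist [DecidableEq V] (hST : Disjoint S T) :
    ∑ u, ∑ v, maxInvDist S T u v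
      = (Fintype.card V : ℝ) ^ 2 - Fintype.card V - (S.card : ℝ) * T.card := by
  have h : ∀ u v, maxInvDist S T u v = 1 - (if u = v then (1 : ℝ) else 0)
      - 1 / 2 * ((if u ∈ S then (1 : ℝ) else 0) * (if v ∈ T then (1 : ℝ) else 0))
      - 1 / 2 * ((if u ∈ T then (1 : ℝ) else 0) * (if v ∈ S then (1 : ℝ) else 0)) := by
    intro u v
    have hu : u ∈ S → u ∉ T := fun h => Finset.disjoint_left.1 hST h
    have hv : v ∈ S → v ∉ T := fun h => Finset.disjoint_left.1 hST h
    unfold maxInvDist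
    by_cases huv : u = v
    · subst huv
      by_cases h1 : u ∈ S
      · simp [h1, hu h1]
      · simp [h1]
    · by_cases h1 : u ∈ S <;> by_cases h2 : v ∈ S
      · simp [huv, h1, h2, hu h1, hv h2]
      · by_cases h3 : v ∈ T
        · simp [huv, h1, h2, h3, hu h1]; norm_num
        · simp [huv, h1, h2, h3, hu h1]
      · by_cases h3 : u ∈ T
        · simp [huv, h1, h2, h3, hv h2]; norm_num
        · simp [huv, h1, h2, h3, hv h2]
      · simp [huv, h1, h2]
  simp_rw [h, Finset.sum_sub_distrib, ← Finset.mul_sum, ← Finset.sum_mul]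
  simp
  ring

theorem IsSeparation.card_add_card (h : IsSeparation G c S T) :
    S.card + T.card + 1 = Fintype.card V := by
  classical
  rw [← Finset.card_union_of_disjoint h.disj, ← Finset.card_univ,
    ← Finset.card_insert_of_notMem (a := c) (by simp [h.notMem_left, h.notMem_right])]
  congr 1
  ext x
  simpa using h.cover x

/-- The Harary index of a clique on `n - 1` vertices with a pendant vertex attached. -/
noncomputable def pendantCliqueH (n : ℕ) : ℝ := (1 / 2) * ((n : ℝ) ^ 2 - n - ((n : ℝ) - 2))

theorem IsSeparation.hararyIndex_le (h : IsSeparation G c S T) :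
    hararyIndex G ≤ pendantCliqueH (Fintype.card V) ∧
      (hararyIndex G = pendantCliqueH (Fintype.card V) → ∃ s, IsPendantClique G s c) := by
  classical
  have hsum := sum_maxInvDist h.disj
  have hcard : (S.card : ℝ) + T.card + 1 = Fintype.card V := by exact_mod_cast h.card_add_card
  have hS : (1 : ℝ) ≤ S.card := by exact_mod_cast h.left_nonempty.card_pos
  have hT : (1 : ℝ) ≤ T.card := by exact_mod_cast h.right_nonempty.card_pos
  -- Equivalent to `|S||T| ≥ |S| + |T| - 1`, which is `n - 2`.
  have hprod : 0 ≤ ((S.card : ℝ) - 1) * (T.card - 1) :=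
    mul_nonneg (sub_nonneg.2 hS) (sub_nonneg.2 hT)
  have hle : ∑ u, ∑ v, (G.dist u v : ℝ)⁻¹ ≤ ∑ u, ∑ v, maxInvDist S T u v :=
    Finset.sum_le_sum fun u _ => Finset.sum_le_sum fun v _ => h.inv_dist_le u v
  unfold hararyIndex pendantCliqueH
  refine ⟨by linarith, fun heq => ?_⟩
  -- Equality of the sums forces equality in every termwise bound.
  have hdist : ∀ u v, (G.dist u v : ℝ)⁻¹ = maxInvDist S T u v := by
    have heq' : ∑ u, ∑ v, (G.dist u v : ℝ)⁻¹ = ∑ u, ∑ v, maxInvDist S T u v := by linarith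
    intro u v
    have h1 := (Finset.sum_eq_sum_iff_of_le fun u _ =>
      Finset.sum_le_sum fun v _ => h.inv_dist_le u v).1 heq' u (Finset.mem_univ u)
    exact (Finset.sum_eq_sum_iff_of_le fun v _ => h.inv_dist_le u v).1 h1 v (Finset.mem_univ v)
  have hadj : ∀ u v, u ≠ v → ¬ ((u ∈ S ∧ v ∈ T) ∨ (u ∈ T ∧ v ∈ S)) → G.Adj u v := by
    intro u v huv hcross
    have h1 := hdist u v
    rw [maxInvDist, if_neg huv, if_neg hcross, inv_eq_one] at h1
    exact SimpleGraph.dist_eq_one_iff_adj.1 (by exact_mod_cast h1)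
  have key : ∀ {A B : Finset V}, IsSeparation G c A B → A.card = 1 →
      (∀ u v, u ≠ v → ¬ ((u ∈ A ∧ v ∈ B) ∨ (u ∈ B ∧ v ∈ A)) → G.Adj u v) →
      ∃ s, IsPendantClique G s c := by
    intro A B hAB hA hadj
    obtain ⟨s, rfl⟩ := Finset.card_eq_one.1 hA
    have hB : ∀ x, x ∈ B ↔ x ≠ s ∧ x ≠ c := by
      intro x
      constructor
      · intro hx
        refine ⟨?_, ?_⟩
        · rintro rfl; exact Finset.disjoint_left.1 hAB.disj (by simp) hx
        · rintro rfl; exact hAB.notMem_right hx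
      · rintro ⟨h1, h2⟩
        have := hAB.cover x
        simp only [Finset.mem_singleton] at this
        tauto
    have hsc : s ≠ c := by rintro rfl; exact hAB.notMem_left (by simp)
    refine ⟨s, hsc, fun x y => ⟨fun hxy => ⟨hxy.ne, ?_, ?_⟩, fun ⟨hne, h1, h2⟩ => ?_⟩⟩
    · rintro rfl
      by_contra hy
      exact hAB.not_adj x (by simp) y ((hB y).2 ⟨hxy.ne', hy⟩) hxy
    · rintro rfl
      by_contra hx
      exact hAB.not_adj y (by simp) x ((hB x).2 ⟨hxy.ne, hx⟩) hxy.symm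
    · refine hadj x y hne ?_
      simp only [Finset.mem_singleton, hB]
      tauto
  have hzero : ((S.card : ℝ) - 1) * (T.card - 1) = 0 := by linarith
  rcases mul_eq_zero.1 hzero with h1 | h1
  · exact key h (by exact_mod_cast sub_eq_zero.1 h1) hadj
  · exact key h.symm (by exact_mod_cast sub_eq_zero.1 h1) fun u v huv hc =>
      hadj u v huv (fun hc' => hc hc'.symm)

/-- The bound is attained with `{s}` and `{s, c}ᶜ` as the two sides: `s` reaches every vertex of the
latter in two steps through `c`. -/
theorem IsPendantClique.hararyIndex_eq (h : IsPendantClique G s c) :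
    hararyIndex G = pendantCliqueH (Fintype.card V) := by
  classical
  obtain ⟨hsc, hadj⟩ := h
  have hdisj : Disjoint ({s} : Finset V) {s, c}ᶜ := by simp
  have hdist : ∀ u v, (G.dist u v : ℝ)⁻¹ = maxInvDist {s} {s, c}ᶜ u v := by
    have hfar : ∀ v, v ≠ s → v ≠ c → G.dist s v = 2 := by
      intro v hvs hvc
      have h1 : G.Adj s c := (hadj s c).2 ⟨hsc, fun _ => rfl, fun h => absurd h hsc.symm⟩
      have h2 : G.Adj c v :=
        (hadj c v).2 ⟨hvc.symm, fun h => absurd h hsc.symm, fun h => absurd h hvs⟩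
      have hle := SimpleGraph.dist_le (SimpleGraph.Walk.cons h1 (SimpleGraph.Walk.cons h2 .nil))
      have hne1 : G.dist s v ≠ 1 := fun h =>
        hvc (((hadj s v).1 (SimpleGraph.dist_eq_one_iff_adj.1 h)).2.1 rfl)
      have hne0 : G.dist s v ≠ 0 := SimpleGraph.dist_ne_zero_iff_ne_and_reachable.2
        ⟨hvs.symm, h1.reachable.trans h2.reachable⟩
      simp only [SimpleGraph.Walk.length_cons, SimpleGraph.Walk.length_nil] at hle
      omega
    intro u v
    unfold maxInvDist
    by_cases huv : u = v
    · simp [huv]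
    rw [if_neg huv]
    simp only [Finset.mem_singleton, Finset.mem_compl, Finset.mem_insert, not_or]
    by_cases h1 : u = s ∧ v ≠ s ∧ v ≠ c
    · rw [if_pos (Or.inl h1), h1.1, hfar v h1.2.1 h1.2.2]; norm_num
    by_cases h2 : (u ≠ s ∧ u ≠ c) ∧ v = s
    · rw [if_pos (Or.inr h2), h2.2, SimpleGraph.dist_comm, hfar u h2.1.1 h2.1.2]; norm_num
    rw [if_neg (not_or.2 ⟨h1, h2⟩), SimpleGraph.dist_eq_one_iff_adj.2 ((hadj u v).2 ⟨huv, ?_, ?_⟩)]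
    · simp
    · rintro rfl
      by_contra hv
      exact h1 ⟨rfl, Ne.symm huv, hv⟩
    · rintro rfl
      by_contra hu
      exact h2 ⟨⟨huv, hu⟩, rfl⟩
  unfold hararyIndex pendantCliqueH
  simp_rw [hdist]
  rw [sum_maxInvDist hdisj, Finset.card_compl, Finset.card_pair hsc, Finset.card_singleton,
    Nat.cast_sub ((Finset.card_pair hsc).symm.le.trans (Finset.card_le_univ _))]
  push_cast
  ring

theorem IsPendantClique.nonempty_iso {W : Type*} [Fintype W] {H : SimpleGraph W} {s' c' : W}
    (h : IsPendantClique G s c) (h' : IsPendantClique H s' c')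
    (hcard : Fintype.card V = Fintype.card W) : Nonempty (G ≃g H) := by
  classical
  obtain ⟨hsc, hadj⟩ := h
  obtain ⟨hsc', hadj'⟩ := h'
  obtain ⟨e, hes, hec⟩ : ∃ e : V ≃ W, e s = s' ∧ e c = c' := by
    let e₀ := Fintype.equivOfCardEq hcard
    let e₁ := e₀.trans (Equiv.swap (e₀ s) s')
    have h1 : e₁ s = s' := by simp [e₁]
    -- The second swap does not disturb `s'`, which differs from both `e₁ c` and `c'`.
    refine ⟨e₁.trans (Equiv.swap (e₁ c) c'), ?_, by simp⟩
    rw [Equiv.trans_apply, Equiv.swap_apply_of_ne_of_ne, h1]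
    · exact fun h => hsc (e₁.injective h)
    · rw [h1]; exact hsc'
  refine ⟨⟨e, fun {x y} => ?_⟩⟩
  rw [hadj, hadj', ← hes, ← hec]
  simp [e.injective.eq_iff]

end

/-! ### The extremal graph and the main theorem -/

theorem graphG_one_isPendantClique (n : ℕ) (hn : 3 ≤ n) :
    ∃ s c, IsPendantClique (graphG n 1) s c := by
  have hlen : ∀ i : Fin (n - 1), evenLengths n 1 i = if i.val = 0 then 1 else 0 := by
    intro i
    unfold evenLengths
    -- As `n - 1 ≥ 2`, the quotient of `1` by `n - 1` is `0` and the remainder is `1`, so only path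
    -- `0` has an edge.
    rw [Nat.div_eq_of_lt (by omega), Nat.mod_eq_of_lt (by omega), zero_add]
    simp
  have hext : ∀ v w : VertexG n 1, v = w ↔ v.1.val = w.1.val ∧ v.2.val = w.2.val := by
    rintro ⟨i, a⟩ ⟨j, b⟩
    constructor
    · intro h; cases h; exact ⟨rfl, rfl⟩
    · rintro ⟨h1, h2⟩
      obtain rfl := Fin.ext h1
      exact congrArg (Sigma.mk i) (Fin.ext h2)
  let z : Fin (n - 1) := ⟨0, by omega⟩
  have hz : evenLengths n 1 z = 1 := by simp [hlen, z]
  refine ⟨⟨z, ⟨1, by omega⟩⟩, ⟨z, ⟨0, by omega⟩⟩, by simp [hext], fun x y => ?_⟩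
  have hb : ∀ v : VertexG n 1, v.2.val = 0 ∨ (v.1.val = 0 ∧ v.2.val = 1) := by
    intro v
    have h1 := v.2.isLt
    have h2 := hlen v.1
    split_ifs at h2 <;> omega
  have hx := hb x
  have hy := hb y
  simp only [graphG, cliqueWithPaths, Ne, hext, Fin.ext_iff, z]
  omega

theorem mainTheorem2 :
    (∀ n : ℕ, 2 ≤ n →
      hararyIndex (⊤ : SimpleGraph (Fin n)) = hararyIndex (graphG n 0) ∧
      (∀ k : ℕ, k + 1 ≤ n - 2 → hararyIndex (graphG n k) > hararyIndex (graphG n (k + 1))) ∧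
      hararyIndex (graphG n (n - 2)) = hararyIndex (SimpleGraph.pathGraph n)) ∧
    (∀ n : ℕ, 3 ≤ n → ∀ (V : Type*) [Fintype V] (G : SimpleGraph V), Fintype.card V = n →
      ((∃ v : V, IsCutVertex G v) ∨ (∃ e : Sym2 V, IsCutEdge G e)) →
      hararyIndex G ≤ hararyIndex (graphG n 1) ∧
      (hararyIndex G = hararyIndex (graphG n 1) ↔ Nonempty (G ≃g graphG n 1))) := by
  refine ⟨fun n hn => ⟨hararyIndex_top_eq n (by omega), fun k hk => hararyIndex_graphG_succ_lt n k hk,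
    hararyIndex_graphG_sub_two n hn⟩, ?_⟩
  intro n hn V _ G hcard hcut
  obtain ⟨c, S, T, hsep⟩ : ∃ (c : V) (S T : Finset V), IsSeparation G c S T := by
    rcases hcut with ⟨v, hv⟩ | ⟨e, he⟩
    · exact ⟨v, hv.exists_isSeparation⟩
    · exact he.exists_isSeparation (by omega)
  obtain ⟨s', c', hG⟩ := graphG_one_isPendantClique n hn
  have hcard' : Fintype.card (VertexG n 1) = n := card_vertexG n 1 (by omega)
  have hle := hsep.hararyIndex_le
  rw [hG.hararyIndex_eq, hcard', ← hcard]
  refine ⟨hle.1, fun heq => ?_, fun ⟨e⟩ => ?_⟩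
  · obtain ⟨s, hs⟩ := hle.2 heq
    rw [hcard]
    exact hs.nonempty_iso hG (hcard.trans hcard'.symm)
  · rw [hcard] at e
    rw [hararyIndex_iso e, hG.hararyIndex_eq, hcard', hcard]
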